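/- **Conventions.** Let $\Xi$ be a finite alphabet with $|\Xi|\ge 2$ and let $L\subseteq\Xi^n$ be a property; $\log$ is the logarithm to base $2$. A word $w\in\Xi^n$ is *$\varepsilon$-far* from $L$ if its Hamming distance to every word of $L$ exceeds $\varepsilon n$. A *non-adaptive algorithm with at most $m$ queries* draws a set $Q\subseteq\{1,\dots,n\}$ with $|Q|\le m$ from a fixed distribution, reads the restriction $w_Q$ of the input $w$ to $Q$, and outputs a bit that depends only on $(Q,w_Q)$ and on fresh randomness. It is a *$1$-sided $(\varepsilon,\delta)$-test* for $L$ if it accepts every $w\in L$ with probability $1$ and rejects every $w$ that is $\varepsilon$-far from $L$ with probability at least $1-\delta$. A *non-adaptive $1$-sided $\mathcal{MAP}$* (Merlin–Arthur proof of proximity) for $L$ with proximity parameter $\varepsilon$, soundness error $\delta$, query complexity $q'$ and proof complexity $p$ consists of a non-adaptive algorithm $V_\pi$ with at most $q'$ queries for every proof $\pi\in\Xi^p$, such that for every $w\in L$ some $V_\pi$ accepts $w$ with probability $1$, while every $w$ that is $\varepsilon$-far from $L$ is accepted by each $V_\pi$ with probability at most $\delta$. (The usual choice is $\delta=1/3$.)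 **Statement.** For every $c>0$ there are $c'>0$ and $N\in\mathbb N$, depending only on $c$, such that the following holds for all finite alphabets $\Xi$ with $|\Xi|\ge2$, all integers $q'\ge2$ and all real $\delta\in[0,1)$, $\varepsilon\in(0,1]$ and $\gamma$. Put $$q=\frac{30\,q'\log q'}{1-\delta},\qquad \alpha_1=\frac{q^3\log|\Xi|}{\varepsilon},$$ and let $n>\bigl(24\,q\,(q+1)^2(\log|\Xi|)^2/\varepsilon\bigr)^{q}$ and $L\subseteq\Xi^n$. If every non-adaptive $1$-sided $(\varepsilon,1/2)$-test for $L$ with at most $m$ queries satisfies $m\ge c\,n^{1-\gamma}$, then every non-adaptive $1$-sided $\mathcal{MAP}$ for $L$ with proximity parameter $\varepsilon/2$, soundness error $\delta$ and query complexity $q'$ has proof complexity $$p\ \ge\ c'\,\frac{n^{q^{-2}-\gamma}}{\alpha_1}-1,$$ and if moreover $n\ge N$ then $$p\ \ge\ c'\left(\frac{n^{q^{-2}-\gamma}}{\alpha_1}-1\right).$$ In short: if $1$-sided non-adaptive testing of $L$ needs $\Omega(n^{1-\gamma})$ queries, then the proof complexity is $\Omega(n^{q^{-2}-\gamma}/\alpha_1-1)$.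 -/

import Mathlib

/-- `w` is `ε`-far from the property `L`: changing at most `ε * n` letters of `w` never gives a word
of `L`. -/
def IsFar {Ξ : Type*} [DecidableEq Ξ] {n : ℕ} (ε : ℝ) (w : Fin n → Ξ) (L : Set (Fin n → Ξ)) : Prop :=
  ∀ v ∈ L, ε * (n : ℝ) < (hammingDist w v : ℝ)

/-- A non-adaptive randomized query algorithm on words of length `n` over `Ξ`: it draws a query set
`Q` from `queryDist`, reads the restriction of the input to `Q`, and draws its output bit from
`output Q` applied to what it has read. -/
structure NonadaptiveAlg (Ξ : Type*) (n : ℕ) where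
  queryDist : PMF (Finset (Fin n))
  output : (Q : Finset (Fin n)) → (Q → Ξ) → PMF Bool

namespace NonadaptiveAlg

/-- The distribution of the output bit on the input `w`. -/
noncomputable def run {Ξ : Type*} {n : ℕ} (A : NonadaptiveAlg Ξ n) (w : Fin n → Ξ) : PMF Bool :=
  A.queryDist.bind fun Q => A.output Q fun i => w i

/-- The probability that the output on the input `w` is the bit `b` (`true` is acceptance). -/
noncomputable def prob {Ξ : Type*} {n : ℕ} (A : NonadaptiveAlg Ξ n) (w : Fin n → Ξ) (b : Bool) : ℝ :=
  (A.run w b).toReal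

/-- The algorithm never makes more than `q` queries. -/
def QueriesAtMost {Ξ : Type*} {n : ℕ} (A : NonadaptiveAlg Ξ n) (q : ℕ) : Prop :=
  ∀ Q ∈ A.queryDist.support, Q.card ≤ q

end NonadaptiveAlg

/-- `A` is a non-adaptive `1`-sided `(ε, δ, q)`-test for `L`. -/
structure IsOneSidedTest {Ξ : Type*} [DecidableEq Ξ] {n : ℕ} (A : NonadaptiveAlg Ξ n)
    (ε δ : ℝ) (q : ℕ) (L : Set (Fin n → Ξ)) : Prop where
  queries : A.QueriesAtMost q
  complete : ∀ w ∈ L, A.prob w true = 1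
  sound : ∀ w, IsFar ε w L → 1 - δ ≤ A.prob w false

/-- `V` is the verifier of a non-adaptive `1`-sided Merlin-Arthur proof of proximity for `L` with
proximity parameter `ε`, soundness error `δ` (classically `1 / 3`), query complexity `q` and proof
complexity `p`. The verifier chooses its query distribution and its decision rule after reading the
whole proof `π`, a word of length `p` over `Ξ`. -/
structure IsOneSidedMAP {Ξ : Type*} [DecidableEq Ξ] {n p : ℕ}
    (V : (Fin p → Ξ) → NonadaptiveAlg Ξ n) (ε δ : ℝ) (q : ℕ) (L : Set (Fin n → Ξ)) : Prop where
  queries : ∀ π, (V π).QueriesAtMost q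
  complete : ∀ w ∈ L, ∃ π, (V π).prob w true = 1
  sound : ∀ w, IsFar ε w L → ∀ π, (V π).prob w true ≤ δ

/-- The number `q = 30 q' log q' / (1 - δ)`, with the logarithm to base `2`. -/
noncomputable def effQ (q' : ℕ) (δ : ℝ) : ℝ :=
  30 * (q' : ℝ) * Real.logb 2 q' / (1 - δ)

/-- The number `α₁ = log s * q ^ 3 / ε` for an alphabet of size `s`. -/
noncomputable def alphaOne (s : ℕ) (q ε : ℝ) : ℝ :=
  Real.logb 2 s * q ^ 3 / ε

/-- The bound `(24 q (q + 1) ^ 2 (log s) ^ 2 / ε) ^ q` on the word length, for an alphabet of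
size `s`. -/
noncomputable def lengthBound (s : ℕ) (q ε : ℝ) : ℝ :=
  (24 * q * (q + 1) ^ 2 * Real.logb 2 s ^ 2 / ε) ^ q

/-! Short proofs would give a cheap test, which simulates the verifier for all proofs on one random
sample. Let `k` be the query complexity of the verifier and `η` its soundness gap. For a fixed
proof, the degree of a point is its probability of being queried; the degrees sum to at most `k`.
Cut the degrees at the thresholds `2k/(εn) * R^i` with `R = n^(1/q)`. By pigeonhole some interval
between consecutive thresholds carries total degree at most `η/2` (`exists_light_gap`). The points
above it form a kernel of at most `εn/2` points; rejecting query sets that avoid the interval still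
weigh `η/2`, and outside the kernel they have only light points. A maximal disjoint family of their
parts outside the kernel (petals) is therefore large (`exists_disjoint_petals`).

The test samples each point with probability `ρ`, guesses the proof and the letters on the kernel,
and accepts if some guess is not refuted by a query set inside sample and kernel. Disjoint petals
are sampled independently, so a fixed guess survives with exponentially small probability
(`sum_not_catches_le`). The factor `R` between consecutive thresholds makes this beat the union
bound over all guesses (`logb_mul_le_of_length`). With `ρ = (p+1) n^(-2/q²)` the test makes about
`4ρn` queries, whence `p + 1 ≥ (c/4) n^(2/q²-γ)`, which is more than is claimed. -/

open Finset

/-! ### Random samples with independent points. -/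

/-- The probability of the set `S` when every point is drawn independently with probability `ρ`. -/
noncomputable def bernoulliWeight {ι : Type*} [Fintype ι] [DecidableEq ι] (ρ : ℝ) (S : Finset ι) : ℝ :=
  (∏ _x ∈ S, ρ) * ∏ _x ∈ univ \ S, (1 - ρ)

section Bernoulli

variable {ι : Type*} [Fintype ι] [DecidableEq ι]

theorem bernoulliWeight_nonneg {ρ : ℝ} (h0 : 0 ≤ ρ) (h1 : ρ ≤ 1) (S : Finset ι) :
    0 ≤ bernoulliWeight ρ S :=
  mul_nonneg (prod_nonneg fun _ _ => h0) (prod_nonneg fun _ _ => sub_nonneg.2 h1)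

/-- Expand the product over all points of `ρ + (1 - ρ) * [x ∉ U]`: the factor kills every `S` that
misses a point of `U`. -/
theorem sum_bernoulliWeight_superset (ρ : ℝ) (U : Finset ι) :
    ∑ S : Finset ι, bernoulliWeight ρ S * (if U ⊆ S then 1 else 0) = ρ ^ #U := by
  have key := Finset.prod_add (fun _ : ι => ρ) (fun x => (1 - ρ) * if x ∈ U then 0 else 1) univ
  rw [powerset_univ] at key
  calc _ = ∑ S : Finset ι, (∏ _x ∈ S, ρ) * ∏ x ∈ univ \ S, (1 - ρ) * (if x ∈ U then 0 else 1) := by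
        refine sum_congr rfl fun S _ => ?_
        rw [bernoulliWeight, mul_assoc, prod_mul_distrib]
        congr 2
        split_ifs with h
        · exact (prod_eq_one fun x hx => if_neg fun hU => (mem_sdiff.1 hx).2 (h hU)).symm
        · obtain ⟨x, hx, hxS⟩ := not_subset.1 h
          exact (prod_eq_zero (i := x) (by simp [hxS]) (by simp [hx])).symm
    _ = ∏ x : ι, (ρ + (1 - ρ) * if x ∈ U then 0 else 1) := key.symm
    _ = ∏ x : ι, (if x ∈ U then ρ else 1) := by
        refine prod_congr rfl fun x _ => ?_
        split_ifs <;> ring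
    _ = _ := by simp

theorem sum_bernoulliWeight (ρ : ℝ) : ∑ S : Finset ι, bernoulliWeight ρ S = 1 := by
  simpa using sum_bernoulliWeight_superset ρ (∅ : Finset ι)

theorem sum_bernoulliWeight_mul_card (ρ : ℝ) :
    ∑ S : Finset ι, bernoulliWeight ρ S * #S = ρ * Fintype.card ι := by
  calc _ = ∑ S : Finset ι, ∑ x : ι, bernoulliWeight ρ S * (if {x} ⊆ S then 1 else 0) := by
        refine sum_congr rfl fun S _ => ?_
        rw [← mul_sum]
        simp
    _ = ∑ x : ι, ρ := by
        rw [sum_comm]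
        exact sum_congr rfl fun x _ => by rw [sum_bernoulliWeight_superset]; simp
    _ = _ := by simp [mul_comm]

/-- Markov's inequality for the sample size. -/
theorem sum_bernoulliWeight_lt_card_le {ρ a : ℝ} (h0 : 0 ≤ ρ) (h1 : ρ ≤ 1) {m : ℕ}
    (hm : ρ * Fintype.card ι ≤ a * (m + 1)) :
    ∑ S : Finset ι with m < #S, bernoulliWeight ρ S ≤ a := by
  have hpos : (0 : ℝ) < m + 1 := by positivity
  refine le_of_mul_le_mul_right ?_ hpos
  refine le_trans ?_ hm
  rw [← sum_bernoulliWeight_mul_card, sum_mul]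
  refine (sum_le_sum fun S hS => ?_).trans (sum_le_sum_of_subset_of_nonneg (filter_subset _ _)
    fun S _ _ => mul_nonneg (bernoulliWeight_nonneg h0 h1 S) (Nat.cast_nonneg _))
  refine mul_le_mul_of_nonneg_left ?_ (bernoulliWeight_nonneg h0 h1 S)
  exact_mod_cast (mem_filter.1 hS).2

/-- Disjoint sets are contained in a random set independently of each other. -/
theorem sum_bernoulliWeight_not_superset (ρ : ℝ) (P : Finset (Finset ι))
    (hP : (P : Set (Finset ι)).PairwiseDisjoint id) :
    ∑ S : Finset ι with ∀ U ∈ P, ¬ U ⊆ S, bernoulliWeight ρ S = ∏ U ∈ P, (1 - ρ ^ #U) := by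
  -- Inclusion–exclusion over the subfamilies `T` of `P`; disjointness enters only through the size
  -- of the union of `T`.
  have expand (f : Finset ι → ℝ) :
      ∏ U ∈ P, (1 - f U) = ∑ T ∈ P.powerset, (-1) ^ #T * ∏ U ∈ T, f U := by
    have := Finset.prod_add (fun U => -f U) (fun _ => (1 : ℝ)) P
    simp only [prod_const_one, mul_one, neg_add_eq_sub] at this
    rw [this]
    exact sum_congr rfl fun T _ => by rw [prod_neg]
  have hind (T : Finset (Finset ι)) (S : Finset ι) :
      ∏ U ∈ T, (if U ⊆ S then (1 : ℝ) else 0) = if T.biUnion id ⊆ S then 1 else 0 := by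
    by_cases h : ∀ U ∈ T, U ⊆ S
    · rw [prod_eq_one fun U hU => if_pos (h U hU), if_pos (biUnion_subset.2 h : T.biUnion id ⊆ S)]
    · rw [if_neg (fun h' => h (biUnion_subset.1 h') : ¬ T.biUnion id ⊆ S)]
      push Not at h
      obtain ⟨U, hU, hUS⟩ := h
      exact prod_eq_zero hU (if_neg hUS)
  calc _ = ∑ S : Finset ι, bernoulliWeight ρ S * ∏ U ∈ P, (1 - if U ⊆ S then 1 else 0) := by
        rw [sum_filter]
        refine sum_congr rfl fun S _ => ?_
        split_ifs with h
        · rw [prod_eq_one fun U hU => by rw [if_neg (h U hU), sub_zero], mul_one]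
        · push Not at h
          obtain ⟨U, hU, hUS⟩ := h
          rw [prod_eq_zero hU (by rw [if_pos hUS, sub_self]), mul_zero]
    _ = ∑ T ∈ P.powerset, (-1) ^ #T *
          ∑ S : Finset ι, bernoulliWeight ρ S * (if T.biUnion id ⊆ S then 1 else 0) := by
        simp_rw [expand, hind, mul_sum]
        rw [sum_comm]
        exact sum_congr rfl fun T _ => sum_congr rfl fun S _ => by ring
    _ = ∑ T ∈ P.powerset, (-1) ^ #T * ∏ U ∈ T, ρ ^ #U := by
        refine sum_congr rfl fun T hT => ?_
        rw [sum_bernoulliWeight_superset, card_biUnion, prod_pow_eq_pow_sum]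
        · rfl
        · exact fun U hU U' hU' hne => hP (mem_powerset.1 hT hU) (mem_powerset.1 hT hU') hne
    _ = _ := (expand _).symm

theorem sum_bernoulliWeight_not_superset_le {ρ : ℝ} (h0 : 0 ≤ ρ) (h1 : ρ ≤ 1) {k : ℕ}
    (P : Finset (Finset ι)) (hP : (P : Set (Finset ι)).PairwiseDisjoint id)
    (hk : ∀ U ∈ P, #U ≤ k) :
    ∑ S : Finset ι with ∀ U ∈ P, ¬ U ⊆ S, bernoulliWeight ρ S ≤ Real.exp (-(#P * ρ ^ k)) := by
  rw [sum_bernoulliWeight_not_superset ρ P hP, ← mul_neg, Real.exp_nat_mul, ← prod_const]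
  refine prod_le_prod (fun U _ => sub_nonneg.2 (pow_le_one₀ h0 h1)) fun U hU => ?_
  have h2 := Real.add_one_le_exp (-ρ ^ k)
  have h3 := pow_le_pow_of_le_one h0 h1 (hk U hU)
  linarith

end Bernoulli

/-! ### Disjoint petals in a weighted family of query sets. -/

section Petals

variable {ι : Type*} [Fintype ι] [DecidableEq ι]

theorem sum_meeting_le (μ : Finset ι → ℝ) (hμ : ∀ Q, 0 ≤ μ Q) (F : Finset (Finset ι))
    (B : Finset ι) (hB : ∀ Q ∈ F, ¬ Disjoint Q B) :
    ∑ Q ∈ F, μ Q ≤ ∑ x ∈ B, ∑ Q with x ∈ Q, μ Q := by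
  calc ∑ Q ∈ F, μ Q ≤ ∑ Q ∈ F, ∑ x ∈ B, if x ∈ Q then μ Q else 0 := by
        refine sum_le_sum fun Q hQ => ?_
        obtain ⟨x, hxQ, hxB⟩ := not_disjoint_iff.1 (hB Q hQ)
        refine le_trans (by simp [hxQ]) (single_le_sum (f := fun x => if x ∈ Q then μ Q else 0)
          (fun y _ => ?_) hxB)
        split_ifs
        exacts [hμ Q, le_rfl]
    _ ≤ ∑ Q, ∑ x ∈ B, if x ∈ Q then μ Q else 0 := by
        refine sum_le_sum_of_subset_of_nonneg (subset_univ _) fun Q _ _ => sum_nonneg fun y _ => ?_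
        split_ifs
        exacts [hμ Q, le_rfl]
    _ = _ := by
        rw [sum_comm]
        exact sum_congr rfl fun x _ => (sum_filter _ _).symm

/-- A heavy family of sets whose points outside `K` are all light has many disjoint petals. -/
theorem exists_disjoint_petals (μ : Finset ι → ℝ) (hμ : ∀ Q, 0 ≤ μ Q) (F : Finset (Finset ι))
    (K : Finset ι) {k : ℕ} {t : ℝ} (ht : 0 ≤ t) (hcard : ∀ Q ∈ F, #Q ≤ k)
    (hne : ∀ Q ∈ F, (Q \ K).Nonempty)
    (hdeg : ∀ Q ∈ F, ∀ x ∈ Q \ K, ∑ Q with x ∈ Q, μ Q ≤ t) :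
    ∃ P ⊆ F.image (· \ K), (P : Set (Finset ι)).PairwiseDisjoint id ∧
      ∑ Q ∈ F, μ Q ≤ #P * (k * t) := by
  classical
  obtain ⟨P, hP, hmax⟩ := exists_max_image
    ((F.image (· \ K)).powerset.filter fun P : Finset (Finset ι) =>
      (P : Set (Finset ι)).PairwiseDisjoint id) (fun P => #P) ⟨∅, by simp⟩
  simp only [mem_filter, mem_powerset] at hP hmax
  refine ⟨P, hP.1, hP.2, ?_⟩
  -- By maximality: the petal of a set missing all of `P` could be added to `P`, being nonempty and
  -- hence not already there.
  have hmeet : ∀ Q ∈ F, ¬ Disjoint Q (P.biUnion id) := by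
    intro Q hQ hdisj
    have hd : ∀ U ∈ P, Disjoint (Q \ K) U := fun U hU =>
      (hdisj.mono_right (subset_biUnion_of_mem id hU)).mono_left sdiff_subset
    have hnot : Q \ K ∉ P := fun h => (hne Q hQ).ne_empty (disjoint_self.1 (hd _ h))
    have := hmax (insert (Q \ K) P) ⟨insert_subset (mem_image_of_mem _ hQ) hP.1, by
      rw [coe_insert, Set.pairwiseDisjoint_insert]
      exact ⟨hP.2, fun U hU _ => hd U hU⟩⟩
    rw [card_insert_of_notMem hnot] at this
    omega
  have hcardP : ∀ U ∈ P, #U ≤ k := fun U hU => by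
    obtain ⟨Q, hQ, rfl⟩ := mem_image.1 (hP.1 hU)
    exact (card_le_card sdiff_subset).trans (hcard Q hQ)
  calc _ ≤ ∑ x ∈ P.biUnion id, ∑ Q with x ∈ Q, μ Q := sum_meeting_le μ hμ F _ hmeet
    _ ≤ ∑ x ∈ P.biUnion id, t := by
        refine sum_le_sum fun x hx => ?_
        obtain ⟨U, hU, hxU⟩ := mem_biUnion.1 hx
        obtain ⟨Q, hQ, rfl⟩ := mem_image.1 (hP.1 hU)
        exact hdeg Q hQ x hxU
    _ = #(P.biUnion id) * t := by simp
    _ ≤ (#P * k : ℕ) * t := by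
        gcongr
        exact card_biUnion_le_card_mul P id k hcardP
    _ = _ := by push_cast; ring

theorem sum_degree_le (μ : Finset ι → ℝ) (hμ : ∀ Q, 0 ≤ μ Q) (hsum : ∑ Q, μ Q = 1) {k : ℕ}
    (hk : ∀ Q, μ Q ≠ 0 → #Q ≤ k) : ∑ x, ∑ Q with x ∈ Q, μ Q ≤ k := by
  calc _ = ∑ Q, ∑ x, if x ∈ Q then μ Q else 0 := by
        simp_rw [sum_filter]
        exact sum_comm
    _ = ∑ Q, #Q * μ Q := by simp
    _ ≤ ∑ Q, k * μ Q := by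
        refine sum_le_sum fun Q _ => ?_
        by_cases h : μ Q = 0
        · simp [h]
        · exact mul_le_mul_of_nonneg_right (by exact_mod_cast hk Q h) (hμ Q)
    _ = k := by rw [← mul_sum, hsum, mul_one]

end Petals

/-! ### Heavy points and a light interval of degrees. -/

section Degrees

variable {ι : Type*} [Fintype ι]

theorem card_heavy_mul_le (W : ι → ℝ) (hW : ∀ x, 0 ≤ W x) (t : ℝ) :
    #{x | t < W x} * t ≤ ∑ x, W x := by
  rw [← nsmul_eq_mul]
  exact (card_nsmul_le_sum _ W t fun x hx => (mem_filter.1 hx).2.le).trans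
    (sum_le_sum_of_subset_of_nonneg (subset_univ _) fun x _ _ => hW x)

/-- Among `g` consecutive intervals of weights, one carries at most a `1 / g` share. -/
theorem exists_light_gap (W : ι → ℝ) (hW : ∀ x, 0 ≤ W x) {a b : ℝ} (hsum : ∑ x, W x ≤ a)
    {τ : ℕ → ℝ} (hτ : Monotone τ) {g : ℕ} (hg : 0 < g) (hab : a ≤ g * b) :
    ∃ i < g, ∑ x with τ i < W x ∧ W x ≤ τ (i + 1), W x ≤ b := by
  by_contra! h
  -- Each interval sum is a difference of tail sums, so the sum over the `g` intervals telescopes.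
  have hgap (i : ℕ) : ∑ x with τ i < W x ∧ W x ≤ τ (i + 1), W x =
      ∑ x with τ i < W x, W x - ∑ x with τ (i + 1) < W x, W x := by
    rw [eq_sub_iff_add_eq, ← sum_filter_add_sum_filter_not (univ.filter fun x => τ i < W x)
      (fun x => W x ≤ τ (i + 1)), filter_filter, filter_filter]
    congr 2
    ext x
    simp only [mem_filter, mem_univ, true_and, not_le]
    exact ⟨fun h => ⟨(hτ (Nat.le_succ i)).trans_lt h, h⟩, fun h => h.2⟩
  have hlt : ∑ i ∈ range g, b < ∑ i ∈ range g, ∑ x with τ i < W x ∧ W x ≤ τ (i + 1), W x :=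
    sum_lt_sum_of_nonempty (nonempty_range_iff.2 hg.ne') fun i hi => h i (mem_range.1 hi)
  simp_rw [hgap] at hlt
  rw [sum_range_sub' (fun i => ∑ x with τ i < W x, W x)] at hlt
  have h1 : ∑ x with τ 0 < W x, W x ≤ ∑ x, W x :=
    sum_le_sum_of_subset_of_nonneg (subset_univ _) fun x _ _ => hW x
  have h2 : 0 ≤ ∑ x with τ g < W x, W x := sum_nonneg fun x _ => hW x
  simp at hlt
  linarith

end Degrees

/-! ### Rejection by a verifier and refutation by a sample. -/

namespace NonadaptiveAlg

variable {Ξ : Type*} {n : ℕ}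

/-- The probability that the query set is `Q`. -/
noncomputable def weight (A : NonadaptiveAlg Ξ n) (Q : Finset (Fin n)) : ℝ :=
  (A.queryDist Q).toReal

/-- The algorithm may reject the word `z` after querying `Q`. -/
def Refutes (A : NonadaptiveAlg Ξ n) (Q : Finset (Fin n)) (z : Fin n → Ξ) : Prop :=
  A.output Q (fun i => z i) false ≠ 0

/-- The sample `S` together with the kernel `K` contains a query set that may reject `z`. -/
def Catches (A : NonadaptiveAlg Ξ n) (K S : Finset (Fin n)) (z : Fin n → Ξ) : Prop :=
  ∃ Q ∈ A.queryDist.support, Q \ K ⊆ S ∧ A.Refutes Q z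

theorem weight_nonneg (A : NonadaptiveAlg Ξ n) (Q : Finset (Fin n)) : 0 ≤ A.weight Q :=
  ENNReal.toReal_nonneg

theorem weight_ne_zero {A : NonadaptiveAlg Ξ n} {Q : Finset (Fin n)} :
    A.weight Q ≠ 0 ↔ Q ∈ A.queryDist.support := by
  rw [weight, ENNReal.toReal_ne_zero, PMF.mem_support_iff]
  exact and_iff_left (PMF.apply_ne_top _ _)

theorem sum_weight (A : NonadaptiveAlg Ξ n) : ∑ Q, A.weight Q = 1 := by
  have h := A.queryDist.tsum_coe
  rw [tsum_fintype] at h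
  simp only [weight]
  rw [← ENNReal.toReal_sum fun Q _ => PMF.apply_ne_top _ _, h, ENNReal.toReal_one]

theorem prob_eq_sum (A : NonadaptiveAlg Ξ n) (w : Fin n → Ξ) (b : Bool) :
    A.prob w b = ∑ Q, A.weight Q * (A.output Q (fun i => w i) b).toReal := by
  rw [prob, run, PMF.bind_apply, tsum_fintype, ENNReal.toReal_sum fun Q _ =>
    ENNReal.mul_ne_top (PMF.apply_ne_top _ _) (PMF.apply_ne_top _ _)]
  exact sum_congr rfl fun Q _ => ENNReal.toReal_mul

theorem prob_true_add_prob_false (A : NonadaptiveAlg Ξ n) (w : Fin n → Ξ) :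
    A.prob w true + A.prob w false = 1 := by
  have h := (A.run w).tsum_coe
  rw [tsum_fintype, Fintype.sum_bool] at h
  rw [prob, prob, ← ENNReal.toReal_add (PMF.apply_ne_top _ _) (PMF.apply_ne_top _ _), h,
    ENNReal.toReal_one]

theorem not_refutes_of_prob_eq_one {A : NonadaptiveAlg Ξ n} {w : Fin n → Ξ}
    (h : A.prob w true = 1) {Q : Finset (Fin n)} (hQ : Q ∈ A.queryDist.support) :
    ¬ A.Refutes Q w := by
  intro hr
  have h0 : A.prob w false = 0 := by linarith [A.prob_true_add_prob_false w]
  rw [prob_eq_sum, sum_eq_zero_iff_of_nonneg fun Q _ =>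
    mul_nonneg (A.weight_nonneg Q) ENNReal.toReal_nonneg] at h0
  refine (mul_ne_zero (weight_ne_zero.2 hQ) ?_) (h0 Q (mem_univ Q))
  exact ENNReal.toReal_ne_zero.2 ⟨hr, PMF.apply_ne_top _ _⟩

open Classical in
theorem prob_false_le (A : NonadaptiveAlg Ξ n) (w : Fin n → Ξ) :
    A.prob w false ≤ ∑ Q with A.Refutes Q w, A.weight Q := by
  rw [prob_eq_sum, sum_filter]
  refine sum_le_sum fun Q _ => ?_
  split_ifs with h
  · refine mul_le_of_le_one_right (A.weight_nonneg Q) ?_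
    exact ENNReal.toReal_le_of_le_ofReal zero_le_one (by simpa using PMF.coe_le_one _ _)
  · rw [Refutes, not_not] at h
    simp [h]

/-- The probability that the point `x` is queried. -/
noncomputable def degree (A : NonadaptiveAlg Ξ n) (x : Fin n) : ℝ :=
  ∑ Q with x ∈ Q, A.weight Q

theorem degree_nonneg (A : NonadaptiveAlg Ξ n) (x : Fin n) : 0 ≤ A.degree x :=
  sum_nonneg fun Q _ => A.weight_nonneg Q

theorem sum_degree_le {A : NonadaptiveAlg Ξ n} {k : ℕ} (hA : A.QueriesAtMost k) :
    ∑ x, A.degree x ≤ k :=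
  _root_.sum_degree_le A.weight A.weight_nonneg A.sum_weight
    fun Q hQ => hA Q (weight_ne_zero.1 hQ)

open Classical in
/-- If few queries fall between the degrees `t` and `t'`, a random sample together with the kernel
of points of degree above `t'` refutes every word that the algorithm rejects often enough. -/
theorem sum_not_catches_le {A : NonadaptiveAlg Ξ n} {k : ℕ} (hk : 0 < k)
    (hA : A.QueriesAtMost k) {ρ : ℝ} (h0 : 0 ≤ ρ) (h1 : ρ ≤ 1) {t t' η : ℝ} (ht : 0 < t)
    (hgap : ∑ x with t < A.degree x ∧ A.degree x ≤ t', A.degree x ≤ η / 2)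
    {z : Fin n → Ξ} (hz : A.prob z true ≤ 1 - η) :
    ∑ S : Finset (Fin n) with ¬ A.Catches {x | t' < A.degree x} S z, bernoulliWeight ρ S ≤ Real.exp (-(ρ ^ k * (η / (2 * k * t)))) := by
  set K : Finset (Fin n) := {x | t' < A.degree x} with hK
  set H : Finset (Fin n) := {x | t < A.degree x ∧ A.degree x ≤ t'} with hH
  set F : Finset (Finset (Fin n)) :=
    {Q | (A.weight Q ≠ 0 ∧ A.Refutes Q z) ∧ Disjoint Q H} with hF
  -- Rejecting sets weigh at least `η`, and those meeting the gap `H` at most its total degree.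
  have hFmass : η / 2 ≤ ∑ Q ∈ F, A.weight Q := by
    have hrej : η ≤ ∑ Q with A.weight Q ≠ 0 ∧ A.Refutes Q z, A.weight Q := by
      have h2 := A.prob_true_add_prob_false z
      have h3 := A.prob_false_le z
      have h4 : ∑ Q with A.Refutes Q z, A.weight Q =
          ∑ Q with A.weight Q ≠ 0 ∧ A.Refutes Q z, A.weight Q := by
        simp_rw [and_comm (a := A.weight _ ≠ 0)]
        rw [← filter_filter, sum_filter_ne_zero]
      linarith
    have hmeet := sum_meeting_le A.weight A.weight_nonneg
      (univ.filter fun Q => (A.weight Q ≠ 0 ∧ A.Refutes Q z) ∧ ¬ Disjoint Q H) H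
      (fun Q hQ => (mem_filter.1 hQ).2.2)
    have hsplit := sum_filter_add_sum_filter_not
      (univ.filter fun Q => A.weight Q ≠ 0 ∧ A.Refutes Q z) (fun Q => Disjoint Q H) A.weight
    rw [filter_filter, filter_filter] at hsplit
    have hHsum : ∑ x ∈ H, ∑ Q with x ∈ Q, A.weight Q ≤ η / 2 := hgap
    linarith
  have hFprop : ∀ Q ∈ F, Q ∈ A.queryDist.support ∧ A.Refutes Q z ∧ Disjoint Q H := by
    intro Q hQ
    obtain ⟨⟨h2, h3⟩, h4⟩ := (mem_filter.1 hQ).2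
    exact ⟨weight_ne_zero.1 h2, h3, h4⟩
  by_cases hne : ∀ Q ∈ F, (Q \ K).Nonempty
  · obtain ⟨P, hPsub, hPdisj, hPmass⟩ := exists_disjoint_petals A.weight A.weight_nonneg F K ht.le
      (fun Q hQ => hA Q (hFprop Q hQ).1) hne (fun Q hQ x hx => by
        by_contra hlt
        have hxQ := (mem_sdiff.1 hx).1
        have hxK : ¬ t' < A.degree x := fun h =>
          (mem_sdiff.1 hx).2 (mem_filter.2 ⟨mem_univ x, h⟩)
        exact disjoint_left.1 (hFprop Q hQ).2.2 hxQ
          (mem_filter.2 ⟨mem_univ x, not_le.1 hlt, not_lt.1 hxK⟩))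
    calc _ ≤ ∑ S : Finset (Fin n) with ∀ U ∈ P, ¬ U ⊆ S, bernoulliWeight ρ S := by
          refine sum_le_sum_of_subset_of_nonneg (fun S hS => ?_)
            fun S _ _ => bernoulliWeight_nonneg h0 h1 S
          refine mem_filter.2 ⟨mem_univ S, fun U hU hUS => (mem_filter.1 hS).2 ?_⟩
          obtain ⟨Q, hQ, rfl⟩ := mem_image.1 (hPsub hU)
          exact ⟨Q, (hFprop Q hQ).1, hUS, (hFprop Q hQ).2.1⟩
      _ ≤ Real.exp (-(#P * ρ ^ k)) := by
          refine sum_bernoulliWeight_not_superset_le h0 h1 P hPdisj fun U hU => ?_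
          obtain ⟨Q, hQ, rfl⟩ := mem_image.1 (hPsub hU)
          exact (card_le_card sdiff_subset).trans (hA Q (hFprop Q hQ).1)
      _ ≤ _ := by
          rw [mul_comm (#P : ℝ)]
          refine Real.exp_le_exp.2 (neg_le_neg (mul_le_mul_of_nonneg_left ?_ (pow_nonneg h0 k)))
          have hk' : (0 : ℝ) < k := by exact_mod_cast hk
          rw [div_le_iff₀ (by positivity)]
          linarith
  -- A refuting query set inside the kernel is caught by every sample, so the failure probability is
  -- zero.
  · push Not at hne
    obtain ⟨Q, hQ, hQK⟩ := hne
    rw [filter_eq_empty_iff.2, sum_empty]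
    · positivity
    · intro S _ hS
      exact hS ⟨Q, (hFprop Q hQ).1, by rw [hQK]; exact empty_subset S, (hFprop Q hQ).2.1⟩

end NonadaptiveAlg

/-! ### From sampling rules to tests. -/

open Classical in
/-- A rule that accepts or rejects after reading a random part of the word gives a test. -/
theorem exists_isOneSidedTest {Ξ : Type*} [Nonempty Ξ] [DecidableEq Ξ] {n m : ℕ} {ε δ : ℝ}
    {L : Set (Fin n → Ξ)} (b : Finset (Fin n) → ℝ) (hb : ∀ S, 0 ≤ b S) (hsum : ∑ S, b S = 1)
    (acc : Finset (Fin n) → (Fin n → Ξ) → Prop)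
    (hloc : ∀ S w w', (∀ i ∈ S, w i = w' i) → acc S w → acc S w')
    (hcomplete : ∀ w ∈ L, ∀ S, acc S w)
    (hsound : ∀ w, IsFar ε w L → ∑ S with #S ≤ m → acc S w, b S ≤ δ) :
    ∃ A : NonadaptiveAlg Ξ n, IsOneSidedTest A ε δ m L := by
  let D : PMF (Finset (Fin n)) := PMF.ofFintype (fun S => ENNReal.ofReal (b S)) (by
    rw [← ENNReal.ofReal_sum_of_nonneg fun S _ => hb S, hsum, ENNReal.ofReal_one])
  let a : Ξ := Classical.arbitrary Ξ
  let ext (S : Finset (Fin n)) (u : S → Ξ) (i : Fin n) : Ξ := if h : i ∈ S then u ⟨i, h⟩ else a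
  let A : NonadaptiveAlg Ξ n :=
    -- An oversized sample is replaced by the empty one; completeness survives, and `hsound` already
    -- counts such samples as accepting.
    { queryDist := D.map fun S => if #S ≤ m then S else ∅
      output := fun S u => PMF.pure (decide (acc S (ext S u))) }
  have hacc (S : Finset (Fin n)) (w : Fin n → Ξ) : acc S (ext S fun i => w i) ↔ acc S w :=
    ⟨hloc S _ _ fun i hi => by simp [ext, hi], hloc S _ _ fun i hi => by simp [ext, hi]⟩
  have hfalse (w : Fin n → Ξ) :
      A.prob w false = ∑ S with ¬ acc (if #S ≤ m then S else ∅) w, b S := by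
    have hrun : A.run w = D.map fun S => decide (acc (if #S ≤ m then S else ∅) w) := by
      simp only [NonadaptiveAlg.run, A, PMF.bind_map, hacc]
      rfl
    rw [NonadaptiveAlg.prob, hrun, PMF.map_apply, tsum_fintype, ENNReal.toReal_sum, sum_filter]
    · refine sum_congr rfl fun S _ => ?_
      by_cases h : acc (if #S ≤ m then S else ∅) w <;> simp [h, D, hb S]
    · intro S _
      split_ifs <;> first | exact PMF.apply_ne_top _ _ | exact ENNReal.zero_ne_top
  refine ⟨A, ⟨?_, fun w hw => ?_, fun w hw => ?_⟩⟩
  · intro Q hQ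
    obtain ⟨S, -, rfl⟩ := (PMF.mem_support_map_iff _ _ _).1 hQ
    split_ifs with h
    · exact h
    · simp
  · have h2 := A.prob_true_add_prob_false w
    rw [hfalse, filter_eq_empty_iff.2 fun S _ => not_not.2 (hcomplete w hw _), sum_empty] at h2
    linarith
  · have h2 := sum_filter_add_sum_filter_not univ
      (fun S => acc (if #S ≤ m then S else ∅) w) b
    have h3 : ∑ S with acc (if #S ≤ m then S else ∅) w, b S ≤ δ := by
      refine le_trans (sum_le_sum_of_subset_of_nonneg (fun S hS => ?_) fun S _ _ => hb S)
        (hsound w hw)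
      refine mem_filter.2 ⟨mem_univ S, fun hm => ?_⟩
      simpa [hm] using (mem_filter.1 hS).2
    rw [hfalse]
    linarith

theorem sum_filter_exists_le {α β : Type*} [Fintype α] [Fintype β] (b : α → ℝ) (hb : ∀ S, 0 ≤ b S)
    (r : β → α → Prop) [∀ a, DecidablePred (r a)] [DecidablePred fun S => ∃ a, r a S] : ∑ S with ∃ a, r a S, b S ≤ ∑ a, ∑ S with r a S, b S := by
  simp_rw [sum_filter]
  rw [sum_comm]
  refine sum_le_sum fun S _ => ?_
  have hnn : ∀ a ∈ univ, 0 ≤ if r a S then b S else 0 := fun a _ => by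
    split_ifs
    exacts [hb S, le_rfl]
  split_ifs with h
  · obtain ⟨a, ha⟩ := h
    exact le_trans (by simp [ha]) (single_le_sum hnn (mem_univ a))
  · exact sum_nonneg hnn

theorem sum_filter_imp_le {α : Type*} [Fintype α] (b : α → ℝ) (hb : ∀ S, 0 ≤ b S)
    (r r' : α → Prop) [DecidablePred r] [DecidablePred r'] [DecidablePred fun S => r S → r' S] :
    ∑ S with r S → r' S, b S ≤ ∑ S with ¬ r S, b S + ∑ S with r' S, b S := by
  simp_rw [sum_filter, ← sum_add_distrib]
  refine sum_le_sum fun S _ => ?_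
  have := hb S
  by_cases h : r S <;> by_cases h' : r' S <;> simp [h, h', this]

/-- The word `w` with its letters in `K` replaced by `κ`. -/
def overwrite {Ξ : Type*} {n : ℕ} (K : Finset (Fin n)) (κ : K → Ξ) (w : Fin n → Ξ) : Fin n → Ξ :=
  fun i => if h : i ∈ K then κ ⟨i, h⟩ else w i

theorem overwrite_self {Ξ : Type*} {n : ℕ} (K : Finset (Fin n)) (w : Fin n → Ξ) :
    overwrite K (fun i => w i) w = w := by
  ext i
  simp [overwrite]

/-- Guessing the kernel letters costs at most half of the distance; this is why the proof system is
only needed at `ε / 2`. -/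
theorem isFar_overwrite {Ξ : Type*} [DecidableEq Ξ] {n : ℕ} {ε : ℝ} {w : Fin n → Ξ}
    {L : Set (Fin n → Ξ)} (hw : IsFar ε w L) {K : Finset (Fin n)} (hK : (#K : ℝ) ≤ ε / 2 * n)
    (κ : K → Ξ) : IsFar (ε / 2) (overwrite K κ w) L := by
  intro v hv
  have h1 := hw v hv
  have h2 : hammingDist w (overwrite K κ w) ≤ #K := by
    refine card_le_card fun i hi => ?_
    by_contra h
    exact (mem_filter.1 hi).2 (by simp [overwrite, h])
  have h3 := hammingDist_triangle w (overwrite K κ w) v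
  have h4 : (hammingDist w v : ℝ) ≤ #K + hammingDist (overwrite K κ w) v := by
    exact_mod_cast h3.trans (Nat.add_le_add_right h2 _)
  linarith

open Classical in
/-- If a random sample refutes each overwriting of the kernels with high enough probability, then
it gives a test. -/
theorem exists_isOneSidedTest_of_kernel {Ξ : Type*} [Fintype Ξ] [Nonempty Ξ] [DecidableEq Ξ]
    {n p k m : ℕ} {ε δ ρ : ℝ} {L : Set (Fin n → Ξ)} {V : (Fin p → Ξ) → NonadaptiveAlg Ξ n}
    (hV : IsOneSidedMAP V (ε / 2) δ k L) (h0 : 0 ≤ ρ) (h1 : ρ ≤ 1) (hm : 4 * ρ * n ≤ m + 1)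
    (K : (Fin p → Ξ) → Finset (Fin n)) (hK : ∀ π, (#(K π) : ℝ) ≤ ε / 2 * n)
    (hbound : ∀ π z, (V π).prob z true ≤ δ → ∑ S : Finset (Fin n) with
      ¬ (V π).Catches (K π) S z, bernoulliWeight ρ S ≤ (4 * (Fintype.card Ξ : ℝ) ^ (p + #(K π)))⁻¹) :
    ∃ A : NonadaptiveAlg Ξ n, IsOneSidedTest A ε (1 / 2) m L := by
  have hbn := bernoulliWeight_nonneg (ι := Fin n) h0 h1
  obtain ⟨acc, hacc⟩ : ∃ acc : Finset (Fin n) → (Fin n → Ξ) → Prop, ∀ S w, acc S w ↔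
      ∃ a : (π : Fin p → Ξ) × (K π → Ξ),
        ¬ (V a.1).Catches (K a.1) S (overwrite (K a.1) a.2 w) := ⟨_, fun _ _ => Iff.rfl⟩
  refine exists_isOneSidedTest (bernoulliWeight ρ) hbn (sum_bernoulliWeight ρ) acc ?_ ?_ ?_
  · intro S w w' hww' h
    obtain ⟨a, ha⟩ := (hacc S w).1 h
    refine (hacc S w').2 ⟨a, fun ⟨Q, hQ, hQS, hQr⟩ => ha ⟨Q, hQ, hQS, ?_⟩⟩
    have : (fun i : Q => overwrite (K a.1) a.2 w i) = fun i : Q => overwrite (K a.1) a.2 w' i := by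
      ext i
      by_cases hi : (i : Fin n) ∈ K a.1
      · simp [overwrite, hi]
      · simp [overwrite, hi, hww' i (hQS (mem_sdiff.2 ⟨i.2, hi⟩))]
    rw [NonadaptiveAlg.Refutes, this]
    exact hQr
  -- The right guess is an accepted proof together with the letters of `w` itself.
  · intro w hw S
    obtain ⟨π, hπ⟩ := hV.complete w hw
    refine (hacc S w).2 ⟨⟨π, fun i => w i⟩, fun ⟨Q, hQ, _, hQr⟩ => ?_⟩
    rw [overwrite_self] at hQr
    exact NonadaptiveAlg.not_refutes_of_prob_eq_one hπ hQ hQr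
  · intro w hw
    -- The error `1/2` splits into `1/4` for oversized samples and `1/4` for the union bound over
    -- guesses.
    have hlarge := sum_bernoulliWeight_lt_card_le (ι := Fin n) (a := 1 / 4) h0 h1 (m := m) (by
      rw [Fintype.card_fin]
      linarith)
    let r (a : (π : Fin p → Ξ) × (K π → Ξ)) (S : Finset (Fin n)) : Prop :=
      ¬ (V a.1).Catches (K a.1) S (overwrite (K a.1) a.2 w)
    have hsmall : ∑ S with acc S w, bernoulliWeight ρ S ≤ 1 / 4 := by
      rw [filter_congr fun S _ => hacc S w]
      refine (sum_filter_exists_le _ hbn r).trans ?_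
      have hr (a : (π : Fin p → Ξ) × (K π → Ξ)) : ∑ S with r a S, bernoulliWeight ρ S ≤
          (4 * (Fintype.card Ξ : ℝ) ^ (p + #(K a.1)))⁻¹ :=
        hbound a.1 _ (hV.sound _ (isFar_overwrite hw (hK a.1) a.2) a.1)
      refine (sum_le_sum fun a _ => hr a).trans ?_
      have hs : (0 : ℝ) < Fintype.card Ξ := by exact_mod_cast Fintype.card_pos
      rw [Fintype.sum_sigma]
      have hin (π : Fin p → Ξ) : ∑ _κ : K π → Ξ, (4 * (Fintype.card Ξ : ℝ) ^ (p + #(K π)))⁻¹ =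
          (4 * (Fintype.card Ξ : ℝ) ^ p)⁻¹ := by
        simp only [sum_const, card_univ, Fintype.card_fun, Fintype.card_coe, nsmul_eq_mul,
          Nat.cast_pow]
        field_simp
        ring
      simp only [hin, sum_const, card_univ, Fintype.card_fun, Fintype.card_fin, nsmul_eq_mul,
        Nat.cast_pow]
      refine le_of_eq ?_
      field_simp
    refine (sum_filter_imp_le _ hbn (fun S => #S ≤ m) (fun S => acc S w)).trans ?_
    simp_rw [not_le]
    linarith

/-- Reading the whole word settles the case where the sampling rate would exceed one. -/
theorem exists_isOneSidedTest_self {Ξ : Type*} [Nonempty Ξ] [DecidableEq Ξ] {n : ℕ} {ε δ : ℝ}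
    (hε : 0 ≤ ε) (hδ : 0 ≤ δ) (L : Set (Fin n → Ξ)) :
    ∃ A : NonadaptiveAlg Ξ n, IsOneSidedTest A ε δ n L := by
  classical
  refine exists_isOneSidedTest (Pi.single univ 1) (fun S => ?_) (by simp)
    (fun S w => ∃ v ∈ L, ∀ i ∈ S, v i = w i) ?_ ?_ ?_
  · by_cases h : S = univ <;> simp [h]
  · rintro S w w' hww' ⟨v, hv, hvw⟩
    exact ⟨v, hv, fun i hi => (hvw i hi).trans (hww' i hi)⟩
  · exact fun w hw S => ⟨w, hw, fun _ _ => rfl⟩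
  · intro w hw
    refine le_trans (sum_nonpos fun S hS => ?_) hδ
    by_cases h : S = univ
    · subst h
      obtain ⟨v, hv, hvw⟩ := (mem_filter.1 hS).2 (by simp)
      obtain rfl : v = w := funext fun i => hvw i (mem_univ i)
      have := hw v hv
      rw [hammingDist_self, Nat.cast_zero] at this
      exact absurd this (not_lt.2 (by positivity))
    · simp [h]

/-! ### Numerical estimates. -/

theorem exp_neg_le_inv {s : ℕ} (hs : 2 ≤ s) {a : ℕ} {x : ℝ}
    (hx : Real.logb 2 s * (a + 2) ≤ x) : Real.exp (-x) ≤ (4 * (s : ℝ) ^ a)⁻¹ := by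
  have hs' : (2 : ℝ) ≤ s := by exact_mod_cast hs
  rw [Real.exp_neg]
  refine inv_anti₀ (by positivity) ?_
  have hlog : Real.log s ≤ Real.logb 2 s := by
    rw [Real.logb, le_div_iff₀ (Real.log_pos one_lt_two)]
    have := Real.log_two_lt_d9
    exact mul_le_of_le_one_right (Real.log_nonneg (by linarith)) (by linarith)
  calc 4 * (s : ℝ) ^ a ≤ s ^ 2 * (s : ℝ) ^ a := by
        gcongr
        nlinarith
    _ = Real.exp (Real.log s * (a + 2)) := by
        rw [← pow_add, add_comm, Real.exp_mul, Real.exp_log (by linarith)]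
        exact_mod_cast (Real.rpow_natCast (s : ℝ) (a + 2)).symm
    _ ≤ _ := by
        refine Real.exp_le_exp.2 (le_trans ?_ hx)
        gcongr

/-- The exponent in the bound on the failure probability beats the size of the kernel and the
length of the proof. -/
theorem logb_mul_le_of_length {k i : ℕ} {η ε Λ q R N u P a : ℝ} (hk : 2 ≤ k) (hη : 0 < η)
    (hη1 : η ≤ 1) (hε : 0 < ε) (hε1 : ε ≤ 1) (hΛ : 1 ≤ Λ) (hq : 30 * k / η ≤ q)
    (hR : 24 * q ^ 3 * Λ ^ 2 / ε ≤ R) (hN : R ^ q = N) (hP : 0 ≤ P)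
    (hu : (P + 1) * R ^ (-(1 / 3) : ℝ) ≤ u) (hi : (i : ℝ) ≤ 2 * k / η)
    (ha : a * (2 * k / (ε * N) * R ^ (i + 1)) ≤ k) :
    Λ * (P + a + 2) ≤ u * (η / (2 * k * (2 * k / (ε * N) * R ^ i))) := by
  have hk' : (2 : ℝ) ≤ k := by exact_mod_cast hk
  have hkη : (k : ℝ) ≤ k / η := by
    rw [le_div_iff₀ hη]
    nlinarith
  have hqk : 30 * (k / η) ≤ q := by rwa [← mul_div_assoc]
  have hq60 : 60 ≤ q := by linarith
  have hεR : 24 * q ^ 3 * Λ ^ 2 ≤ ε * R := by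
    rwa [div_le_iff₀ hε, mul_comm R] at hR
  have hR0 : 0 < R := by
    by_contra h
    have h2 : ε * R ≤ 0 := mul_nonpos_of_nonneg_of_nonpos hε.le (not_lt.1 h)
    have h3 : 0 < 24 * q ^ 3 * Λ ^ 2 := by positivity
    linarith
  have hRbig : 24 * q ^ 3 * Λ ^ 2 ≤ R := hεR.trans (mul_le_of_le_one_left hR0.le hε1)
  have hq3 : 1 ≤ q ^ 3 := one_le_pow₀ (by linarith)
  have hΛ2 : 1 ≤ Λ ^ 2 := one_le_pow₀ hΛ
  have hq3Λ : 1 ≤ q ^ 3 * Λ ^ 2 := one_le_mul_of_one_le_of_one_le hq3 hΛ2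
  have hR1 : 1 ≤ R := by linarith
  have hN0 : 0 < N := hN ▸ Real.rpow_pos_of_pos hR0 q
  -- `2 * E` bounds the kernel size `a`, while the number of petals is of order `R * E`: the extra
  -- `R` is the gain from the gap.
  set E : ℝ := ε * N / (4 * R ^ (i + 1)) with hE
  have hE1 : 1 ≤ E := by
    rw [hE, one_le_div (by positivity)]
    have h2 : R ^ (i + 2) ≤ N := by
      rw [← hN, ← Real.rpow_natCast]
      refine Real.rpow_le_rpow_of_exponent_le hR1 ?_
      push_cast
      rw [mul_div_assoc] at hi
      linarith
    calc 4 * R ^ (i + 1) ≤ (ε * R) * R ^ (i + 1) := by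
          gcongr
          linarith
      _ = ε * R ^ (i + 2) := by ring
      _ ≤ ε * N := by gcongr
  have haE : a ≤ 2 * E := by
    have h2 : a * (2 * k / (ε * N) * R ^ (i + 1)) = a * k / (2 * E) := by
      rw [hE]
      field_simp
      ring
    rw [h2, div_le_iff₀ (by positivity)] at ha
    nlinarith
  set Y : ℝ := R ^ (1 / 3 : ℝ) with hY
  have hY0 : 0 < Y := Real.rpow_pos_of_pos hR0 _
  have hY3 : Y ^ 3 = R := by
    rw [hY, ← Real.rpow_natCast, ← Real.rpow_mul hR0.le]
    norm_num
  -- The sampling loss costs `R^(1/3)` of that gain; the remaining `R^(2/3)` must absorb `4 q² Λ`.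
  -- Cubing reduces this to the lower bound on `R`.
  have hY2 : 4 * q ^ 2 * Λ ≤ Y ^ 2 := by
    by_contra h
    have h2 : (Y ^ 2) ^ 3 < (4 * q ^ 2 * Λ) ^ 3 :=
      pow_lt_pow_left₀ (not_le.1 h) (by positivity) (by norm_num)
    have h3 : (24 * q ^ 3 * Λ ^ 2) ^ 2 ≤ R ^ 2 := pow_le_pow_left₀ (by positivity) hRbig 2
    have h4 : (Y ^ 2) ^ 3 = R ^ 2 := by rw [← hY3]; ring
    have h5 : (4 * q ^ 2 * Λ) ^ 3 ≤ (24 * q ^ 3 * Λ ^ 2) ^ 2 := by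
      have h6 : q ^ 6 * Λ ^ 3 ≤ q ^ 6 * Λ ^ 4 := by
        gcongr
        norm_num
      have h7 : 0 ≤ q ^ 6 * Λ ^ 4 := by positivity
      nlinarith
    linarith
  have huR : 4 * q ^ 2 * Λ * (P + 1) ≤ u * R := by
    rw [Real.rpow_neg hR0.le, ← hY] at hu
    calc 4 * q ^ 2 * Λ * (P + 1) ≤ Y ^ 2 * (P + 1) := by gcongr
      _ = (P + 1) * Y⁻¹ * R := by
          rw [← hY3]
          field_simp
      _ ≤ u * R := by gcongr
  have hqη : (k : ℝ) ^ 2 ≤ q ^ 2 * η := by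
    have h2 : (30 * (k / η)) ^ 2 * η ≤ q ^ 2 * η := by gcongr
    have h3 : (30 * (k / η)) ^ 2 * η = 900 * k * (k / η) := by
      field_simp
      ring
    nlinarith
  have hrhs : u * (η / (2 * k * (2 * k / (ε * N) * R ^ i))) = (u * R) * (η * E) / k ^ 2 := by
    rw [hE]
    field_simp
    ring
  rw [hrhs, le_div_iff₀ (by positivity)]
  calc Λ * (P + a + 2) * k ^ 2 ≤ Λ * (4 * (P + 1) * E) * (q ^ 2 * η) := by
        have hPE : P ≤ P * E := le_mul_of_one_le_right hP hE1
        gcongr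
        linarith
    _ = (4 * q ^ 2 * Λ * (P + 1)) * (η * E) := by ring
    _ ≤ (u * R) * (η * E) := by gcongr

theorem one_le_logb_two {s : ℕ} (hs : 2 ≤ s) : 1 ≤ Real.logb 2 s := by
  rw [Real.le_logb_iff_rpow_le one_lt_two (by exact_mod_cast (by omega : 0 < s)), Real.rpow_one]
  exact_mod_cast hs

/-! ### The test obtained from a proof system, and the lower bound. -/

open Classical in
/-- A Merlin-Arthur proof of proximity with short proofs gives a test with few queries. -/
theorem IsOneSidedMAP.exists_isOneSidedTest {Ξ : Type*} [Fintype Ξ] [DecidableEq Ξ]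
    (hs : 2 ≤ Fintype.card Ξ) {n p k m : ℕ} {ε η ρ q R : ℝ} {L : Set (Fin n → Ξ)}
    {V : (Fin p → Ξ) → NonadaptiveAlg Ξ n} (hV : IsOneSidedMAP V (ε / 2) (1 - η) k L)
    (hk : 2 ≤ k) (hη : 0 < η) (hη1 : η ≤ 1) (hε : 0 < ε) (hε1 : ε ≤ 1) (hn : 0 < n)
    (hq : 30 * k / η ≤ q) (hR1 : 1 ≤ R)
    (hR : 24 * q ^ 3 * Real.logb 2 (Fintype.card Ξ) ^ 2 / ε ≤ R) (hRn : R ^ q = n)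
    (h0 : 0 ≤ ρ) (h1 : ρ ≤ 1) (hρ : (p + 1) * R ^ (-(1 / 3) : ℝ) ≤ ρ ^ k)
    (hm : 4 * ρ * n ≤ m + 1) :
    ∃ A : NonadaptiveAlg Ξ n, IsOneSidedTest A ε (1 / 2) m L := by
  have : Nonempty Ξ := Fintype.card_pos_iff.1 (by omega)
  have hk0 : 0 < k := by omega
  have hk' : (0 : ℝ) < k := by exact_mod_cast hk0
  have hn' : (0 : ℝ) < n := by exact_mod_cast hn
  have hΛ : 1 ≤ Real.logb 2 (Fintype.card Ξ) := one_le_logb_two hs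
  set g : ℕ := ⌈2 * k / η⌉₊ with hg
  have hg0 : 0 < g := Nat.ceil_pos.2 (by positivity)
  set τ : ℕ → ℝ := fun i => 2 * k / (ε * n) * R ^ i with hτ
  have hτmono : Monotone τ := fun i j hij => by
    simp only [hτ]
    gcongr
  have hgap (π : Fin p → Ξ) := exists_light_gap (V π).degree (V π).degree_nonneg
    (NonadaptiveAlg.sum_degree_le (hV.queries π)) hτmono hg0 (b := η / 2) (by
      have := Nat.le_ceil (2 * k / η)
      rw [div_le_iff₀ hη] at this
      linarith)
  choose i hig hi using hgap
  have hcard (π : Fin p → Ξ) :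
      #{x | τ (i π + 1) < (V π).degree x} * τ (i π + 1) ≤ (k : ℝ) :=
    (card_heavy_mul_le _ (V π).degree_nonneg _).trans
      (NonadaptiveAlg.sum_degree_le (hV.queries π))
  refine exists_isOneSidedTest_of_kernel hV h0 h1 hm
    (fun π => {x | τ (i π + 1) < (V π).degree x}) (fun π => ?_) fun π z hz => ?_
  · have h2 : 2 * k / (ε * n) ≤ τ (i π + 1) :=
      le_mul_of_one_le_right (by positivity) (one_le_pow₀ hR1)
    have h3 := (mul_le_mul_of_nonneg_left h2 (Nat.cast_nonneg _)).trans (hcard π)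
    rw [mul_div_assoc', div_le_iff₀ (by positivity)] at h3
    nlinarith
  · refine (NonadaptiveAlg.sum_not_catches_le hk0 (hV.queries π) h0 h1 (t := τ (i π))
      (by positivity) (hi π) hz).trans (exp_neg_le_inv hs ?_)
    have hi2 : (i π : ℝ) ≤ 2 * k / η := (Nat.lt_ceil.1 (hig π)).le
    have := logb_mul_le_of_length hk hη hη1 hε hε1 hΛ hq hR hRn (Nat.cast_nonneg p) hρ hi2
      (hcard π)
    push_cast
    exact this

/-- The rate `ρ` is proportional to `p + 1`, so the query bound `4ρn` turns the testing lower bound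
into one that is linear in the proof length. -/
theorem IsOneSidedMAP.rpow_le_proof_length {Ξ : Type*} [Fintype Ξ] [DecidableEq Ξ]
    (hs : 2 ≤ Fintype.card Ξ) {n p k : ℕ} {c γ ε η q R : ℝ} {L : Set (Fin n → Ξ)}
    {V : (Fin p → Ξ) → NonadaptiveAlg Ξ n} (hV : IsOneSidedMAP V (ε / 2) (1 - η) k L)
    (hk : 2 ≤ k) (hη : 0 < η) (hη1 : η ≤ 1) (hε : 0 < ε) (hε1 : ε ≤ 1) (hn : 0 < n)
    (hq : 30 * k / η ≤ q) (hR1 : 1 ≤ R)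
    (hR : 24 * q ^ 3 * Real.logb 2 (Fintype.card Ξ) ^ 2 / ε ≤ R) (hRn : R ^ q = n)
    (hL : ∀ (m : ℕ) (A : NonadaptiveAlg Ξ n), IsOneSidedTest A ε (1 / 2) m L →
      c * (n : ℝ) ^ (1 - γ) ≤ m) :
    c * (n : ℝ) ^ (2 / q ^ 2 - γ) ≤ 4 * (p + 1) := by
  have : Nonempty Ξ := Fintype.card_pos_iff.1 (by omega)
  have hn' : (0 : ℝ) < n := by exact_mod_cast hn
  have hk' : (2 : ℝ) ≤ k := by exact_mod_cast hk
  have hqk : 30 * k ≤ q := by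
    refine le_trans ?_ hq
    rw [le_div_iff₀ hη]
    nlinarith
  have hq0 : 0 < q := by linarith
  set ρ : ℝ := (p + 1) * (n : ℝ) ^ (-(2 / q ^ 2)) with hρ
  have hsplit : c * (n : ℝ) ^ (2 / q ^ 2 - γ) =
      c * (n : ℝ) ^ (1 - γ) * (n : ℝ) ^ (2 / q ^ 2) / n := by
    rw [eq_div_iff hn'.ne', mul_assoc, mul_assoc, ← Real.rpow_add hn']
    nth_rw 2 [← Real.rpow_one (n : ℝ)]
    rw [← Real.rpow_add hn']
    ring_nf
  have hρn : ρ * (n : ℝ) ^ (2 / q ^ 2) = p + 1 := by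
    rw [hρ, mul_assoc, ← Real.rpow_add hn', neg_add_cancel, Real.rpow_zero, mul_one]
  have hρ0 : 0 < ρ := by positivity
  have hpow : (0 : ℝ) < (n : ℝ) ^ (2 / q ^ 2) := Real.rpow_pos_of_pos hn' _
  suffices h : c * (n : ℝ) ^ (1 - γ) ≤ 4 * ρ * n by
    rw [hsplit, div_le_iff₀ hn', ← hρn]
    nlinarith
  -- For `ρ > 1` the test reading all `n < 4ρn` letters suffices.
  rcases le_or_gt ρ 1 with hρ1 | hρ1
  · obtain ⟨A, hA⟩ := hV.exists_isOneSidedTest hs hk hη hη1 hε hε1 hn hq hR1 hR hRn hρ0.le hρ1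
      (m := ⌊4 * ρ * n⌋₊) (by
        -- Here `p + 1 ≤ (p + 1)^k` and `n^(-2k/q²) = R^(-2k/q)`, where `2k/q ≤ 1/3` because `q ≥
        -- 30k`.
        rw [hρ, mul_pow]
        refine mul_le_mul (le_self_pow₀ (by linarith [Nat.cast_nonneg (α := ℝ) p]) (by omega)) ?_
          (by positivity) (by positivity)
        rw [← hRn, ← Real.rpow_mul (by linarith), ← Real.rpow_mul_natCast (by linarith)]
        refine Real.rpow_le_rpow_of_exponent_le hR1 ?_
        have : q * -(2 / q ^ 2) * k = -(2 * k / q) := by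
          field_simp
        rw [this, neg_le_neg_iff, div_le_div_iff₀ hq0 (by norm_num)]
        linarith) (Nat.lt_floor_add_one _).le
    exact (hL _ A hA).trans (Nat.floor_le (by positivity))
  · obtain ⟨A, hA⟩ := exists_isOneSidedTest_self hε.le (by norm_num : (0 : ℝ) ≤ 1 / 2) L
    refine (hL _ A hA).trans ?_
    nlinarith

/-- Either `q ≥ 4/c` and `α` alone is large enough, or `q < 4/c` bounds the root taken of `n`, so a
threshold on `n` depending only on `c` suffices. -/
theorem four_le_mul_rpow {c n q α : ℝ} (hc : 0 < c) (hq : 1 ≤ q) (hα : q ≤ α)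
    (hn1 : 1 ≤ n) (hn : (4 / c) ^ ((4 / c) ^ 2) ≤ n) : 4 ≤ c * (α * n ^ (1 / q ^ 2)) := by
  have h1 : 1 ≤ n ^ (1 / q ^ 2) := Real.one_le_rpow hn1 (by positivity)
  suffices h : 4 / c ≤ α * n ^ (1 / q ^ 2) by rwa [div_le_iff₀' hc] at h
  rcases le_or_gt (4 / c) q with h | h
  · exact h.trans (hα.trans (le_mul_of_one_le_right (by linarith) h1))
  · have hc4 : 0 < 4 / c := by positivity
    have h2 : 4 / c ≤ n ^ (1 / q ^ 2) := by
      calc 4 / c = ((4 / c) ^ ((4 / c) ^ 2)) ^ (1 / (4 / c) ^ 2) := by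
            rw [← Real.rpow_mul hc4.le, mul_one_div_cancel (by positivity), Real.rpow_one]
        _ ≤ n ^ (1 / (4 / c) ^ 2) := by gcongr
        _ ≤ _ := by
            refine Real.rpow_le_rpow_of_exponent_le hn1 ?_
            gcongr
    exact h2.trans (le_mul_of_one_le_left (by positivity) (by linarith))

theorem mainTheorem10 (c : ℝ) (hc : 0 < c) :
    ∃ c' : ℝ, 0 < c' ∧ ∃ N : ℕ,
      ∀ (Ξ : Type*) [Fintype Ξ] [DecidableEq Ξ], 2 ≤ Fintype.card Ξ →
      ∀ (q' : ℕ) (δ ε γ : ℝ), 2 ≤ q' → 0 ≤ δ → δ < 1 → 0 < ε → ε ≤ 1 →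
      ∀ n : ℕ, lengthBound (Fintype.card Ξ) (effQ q' δ) ε < (n : ℝ) →
      ∀ L : Set (Fin n → Ξ),
        (∀ (m : ℕ) (A : NonadaptiveAlg Ξ n), IsOneSidedTest A ε (1 / 2) m L →
          c * (n : ℝ) ^ (1 - γ) ≤ (m : ℝ)) →
        ∀ (p : ℕ) (V : (Fin p → Ξ) → NonadaptiveAlg Ξ n), IsOneSidedMAP V (ε / 2) δ q' L →
          c' * ((n : ℝ) ^ (1 / effQ q' δ ^ 2 - γ)
              / alphaOne (Fintype.card Ξ) (effQ q' δ) ε) - 1 ≤ (p : ℝ) ∧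
          (N ≤ n → c' * ((n : ℝ) ^ (1 / effQ q' δ ^ 2 - γ)
              / alphaOne (Fintype.card Ξ) (effQ q' δ) ε - 1) ≤ (p : ℝ)) := by
  refine ⟨c / 8, by positivity, ⌈(4 / c) ^ ((4 / c) ^ 2)⌉₊, ?_⟩
  intro Ξ _ _ hs q' δ ε γ hq' hδ0 hδ1 hε hε1 n hn L hL p V hV
  set q : ℝ := effQ q' δ with hqdef
  set Λ : ℝ := Real.logb 2 (Fintype.card Ξ) with hΛdef
  set α : ℝ := alphaOne (Fintype.card Ξ) q ε with hαdef
  have hη : 0 < 1 - δ := by linarith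
  have hΛ : 1 ≤ Λ := one_le_logb_two hs
  have hq2 : (2 : ℝ) ≤ q' := by exact_mod_cast hq'
  have hq : 30 * q' / (1 - δ) ≤ q := by
    rw [hqdef, effQ]
    exact div_le_div_of_nonneg_right
      (le_mul_of_one_le_right (by positivity) (one_le_logb_two hq')) hη.le
  have hq60 : 60 ≤ q := by
    refine le_trans ?_ hq
    rw [le_div_iff₀ hη]
    nlinarith
  have hq0 : 0 < q := by linarith
  have hbase : 24 * q ^ 3 * Λ ^ 2 / ε ≤ 24 * q * (q + 1) ^ 2 * Λ ^ 2 / ε := by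
    have h2 : q ^ 3 ≤ q * (q + 1) ^ 2 := by nlinarith
    rw [mul_assoc 24 q]
    gcongr
  have hn0 : (0 : ℝ) < n := lt_of_le_of_lt (Real.rpow_nonneg (by positivity) _) hn
  have hα : q ≤ α := by
    have h3 : q ≤ q ^ 3 := le_self_pow₀ (by linarith) (by norm_num)
    have h4 : q ^ 3 ≤ Λ * q ^ 3 := le_mul_of_one_le_left (by positivity) hΛ
    have h5 : Λ * q ^ 3 ≤ Λ * q ^ 3 / ε := le_div_self (by positivity) hε hε1
    exact h3.trans (h4.trans h5)
  have hα0 : 0 < α := hq0.trans_le hα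
  set R : ℝ := (n : ℝ) ^ (1 / q) with hRdef
  have hR : 24 * q ^ 3 * Λ ^ 2 / ε ≤ R := by
    refine hbase.trans ?_
    rw [hRdef, one_div, Real.le_rpow_inv_iff_of_pos (by positivity) hn0.le hq0]
    exact hn.le
  have hRn : R ^ q = n := by
    rw [hRdef, ← Real.rpow_mul hn0.le, one_div_mul_cancel hq0.ne', Real.rpow_one]
  have hn1 : (1 : ℝ) ≤ n := by exact_mod_cast (by exact_mod_cast hn0 : 0 < n)
  have hmain := IsOneSidedMAP.rpow_le_proof_length hs (η := 1 - δ) (by simpa using hV) hq' hη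
    (by linarith) hε hε1 (by exact_mod_cast hn0) hq (Real.one_le_rpow hn1 (by positivity)) hR hRn hL
  set X : ℝ := (n : ℝ) ^ (1 / q ^ 2 - γ) / α with hX
  have hX0 : 0 ≤ X := by positivity
  have hsplit : (n : ℝ) ^ (2 / q ^ 2 - γ) = X * (α * (n : ℝ) ^ (1 / q ^ 2)) := by
    rw [hX, ← mul_assoc, div_mul_cancel₀ _ hα0.ne', ← Real.rpow_add hn0]
    ring_nf
  rw [hsplit] at hmain
  have hpow : 1 ≤ (n : ℝ) ^ (1 / q ^ 2) := Real.one_le_rpow hn1 (by positivity)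
  have hαn : 1 ≤ α * (n : ℝ) ^ (1 / q ^ 2) :=
    one_le_mul_of_one_le_of_one_le (by linarith) hpow
  have hcX : c * X ≤ 4 * (p + 1) :=
    le_trans (mul_le_mul_of_nonneg_left (le_mul_of_one_le_right hX0 hαn) hc.le) hmain
  refine ⟨by linarith [Nat.cast_nonneg (α := ℝ) p], fun hN => ?_⟩
  -- For `p ≥ 1` the bound `p + 1 ≤ 2p` explains `c' = c/8`. For `p = 0` the surplus `α * n^(1/q²)`
  -- in `hmain` forces `X ≤ 1`, making the claimed bound nonpositive.
  rcases Nat.eq_zero_or_pos p with rfl | hp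
  · have h4 := four_le_mul_rpow hc (by linarith) hα hn1 (Nat.ceil_le.1 hN)
    have hX1 : X ≤ 1 := by
      by_contra h
      push Not at h
      rw [Nat.cast_zero] at hmain
      nlinarith
    rw [Nat.cast_zero]
    exact mul_nonpos_of_nonneg_of_nonpos (by positivity) (by linarith)
  · have hp1 : (1 : ℝ) ≤ p := by exact_mod_cast hp
    linarith
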